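/- Let $S^n\subset\mathbb R^{n+1}$ be the unit sphere with its round metric $g$, and let $F:\mathbb R^{n+1}\to\mathbb C$ be a homogeneous polynomial with complex coefficients whose restriction $f=F|_{S^n}$ is a $(\lambda,\mu)$-eigenfunction for some $\lambda,\mu\in\mathbb C$, i.e. $\Delta_g f=\lambda f$ and $g(\operatorname{grad} f,\operatorname{grad} f)=\mu f^2$, where $\Delta_g=\operatorname{div}\operatorname{grad}$ is the Laplace–Beltrami operator and $g$ is extended complex bilinearly. Let $(a,b)\in\mathbb R^2\setminus\{(0,0)\}$, let $l\subset\mathbb C$ be the line $au+bv=0$ (in the coordinate $u+iv$), and set $P=a\operatorname{Re}F+b\operatorname{Im}F$. (1) Suppose that $F$ is a submersion at every point of $f^{-1}(l)$, i.e. for every $x\in S^n$ with $F(x)\in l$ the differential $dF_x:\mathbb R^{n+1}\to\mathbb C$ is surjective. Then $f^{-1}(l)$ is a minimal hypersurface of $S^n$ (a smooth embedded submanifold of codimension one with zero mean curvature) if and only if $$\operatorname{Hess}P(\operatorname{grad}P(x),\operatorname{grad}P(x))=0\quad\text{for all }x\in F^{-1}(l).$$ (2) Without that assumption, the same condition holds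 for all $x\in F^{-1}(l)$ if and only if the set of those points of $f^{-1}(l)$ at which $F$ is a submersion is a minimal hypersurface of $S^n$. In both parts $\operatorname{grad}P$ and $\operatorname{Hess}P$ are taken in $\mathbb R^{n+1}$, and the empty set counts as a minimal hypersurface. -/

import Mathlib

open scoped ContDiff Manifold

namespace SphereEigen

/-- The Euclidean space `ℝ^{n+1}`. -/
abbrev Euc (n : ℕ) : Type := EuclideanSpace ℝ (Fin (n + 1))

/-- The standard unit sphere `S^n ⊆ ℝ^{n+1}`. -/
abbrev Sph (n : ℕ) : Type := Metric.sphere (0 : Euc n) 1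

noncomputable section

/-- `∑ ⟪D V_x e_i, e_i⟫` over an orthonormal basis `(e_i)` of the subspace `K` (the trace over `K`
of the derivative of the vector field `V`; it does not depend on the basis). If `K` is the tangent
space at `x` of a submanifold, it depends only on the values of `V` on that submanifold. -/
def traceDeriv {n : ℕ} (K : Submodule ℝ (Euc n)) (V : Euc n → Euc n) (x : Euc n) : ℝ :=
  ∑ i, inner ℝ (fderiv ℝ V x (stdOrthonormalBasis ℝ K i : Euc n)) (stdOrthonormalBasis ℝ K i : Euc n)

/-! ### Gradient and Laplace–Beltrami operator of the round sphere -/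

/-- The extension of a function on the sphere that is constant along rays from the origin
(with the value `0` at the origin). -/
def rayExtend {n : ℕ} (u : Sph n → ℝ) (y : Euc n) : ℝ :=
  if hy : y = 0 then 0
  else u ⟨‖y‖⁻¹ • y, by
    rw [mem_sphere_zero_iff_norm, norm_smul, norm_inv, norm_norm,
      inv_mul_cancel₀ (norm_ne_zero_iff.mpr hy)]⟩

/-- The gradient field of a function `u` on the sphere. At a point `x` of the sphere its value is
the Riemannian gradient of `u`: the ray extension of `u` has radial derivative zero, and along the
sphere it is `u`. -/
def gradField {n : ℕ} (u : Sph n → ℝ) : Euc n → Euc n :=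
  gradient (rayExtend u)

/-- The Laplace–Beltrami operator `Δ u = div grad u` of the round metric on real functions. The
divergence is the trace over the tangent space `x^⊥` of the Levi-Civita derivative, which is the
tangential part of the Euclidean derivative. -/
def laplaceBeltrami {n : ℕ} (u : Sph n → ℝ) (x : Sph n) : ℝ :=
  traceDeriv ((ℝ ∙ (x : Euc n))ᗮ) (gradField u) x

/-- The Laplace–Beltrami operator on complex functions. -/
def laplaceBeltramiC {n : ℕ} (f : Sph n → ℂ) (x : Sph n) : ℂ :=
  (laplaceBeltrami (fun y => (f y).re) x : ℂ) +
    Complex.I * (laplaceBeltrami (fun y => (f y).im) x : ℂ)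

/-- `g(grad f, grad f)`, where the round metric `g` is extended complex bilinearly: for
`f = u + i v` it is `g(grad u, grad u) - g(grad v, grad v) + 2 i g(grad u, grad v)`. -/
def gradSq {n : ℕ} (f : Sph n → ℂ) (x : Sph n) : ℂ :=
  ((inner ℝ (gradField (fun y => (f y).re) x) (gradField (fun y => (f y).re) x) : ℝ) : ℂ) -
    ((inner ℝ (gradField (fun y => (f y).im) x) (gradField (fun y => (f y).im) x) : ℝ) : ℂ) +
    2 * Complex.I *
      ((inner ℝ (gradField (fun y => (f y).re) x) (gradField (fun y => (f y).im) x) : ℝ) : ℂ)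

/-- A smooth function `f : S^n → ℂ` is a `(lam, mu)`-eigenfunction if
`Δ f = lam f` and `g(grad f, grad f) = mu f ^ 2`. -/
structure IsEigenfunction {n : ℕ} (f : Sph n → ℂ) (lam mu : ℂ) : Prop where
  smooth : ContMDiff (𝓡 n) 𝓘(ℝ, ℂ) ∞ f
  laplace : ∀ x, laplaceBeltramiC f x = lam * f x
  grad : ∀ x, gradSq f x = mu * f x ^ 2

/-! ### Minimal hypersurfaces of the sphere -/

/-- The component of the gradient of `φ` tangent to the sphere, at a point `y` of the sphere. -/
def tanGrad {n : ℕ} (φ : Euc n → ℝ) (y : Euc n) : Euc n :=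
  gradient φ y - (inner ℝ (gradient φ y) y : ℝ) • y

/-- `φ` is a local defining function of `M ⊆ S^n` on the open set `W`: it is smooth on `W`, inside
`W` the set `M` is the zero set of `φ` on the sphere, and the restriction of `φ` to the sphere has
nonzero differential at the points of `M` in `W`. -/
structure IsLocalDefining {n : ℕ} (M : Set (Sph n)) (W : Set (Euc n)) (φ : Euc n → ℝ) : Prop where
  isOpen : IsOpen W
  smooth : ContDiffOn ℝ ∞ φ W
  mem_iff : ∀ y : Sph n, (y : Euc n) ∈ W → (y ∈ M ↔ φ y = 0)
  regular : ∀ y : Sph n, (y : Euc n) ∈ W → y ∈ M → tanGrad φ y ≠ 0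

/-- `M ⊆ S^n` is a smooth embedded submanifold of codimension one. -/
def IsHypersurface {n : ℕ} (M : Set (Sph n)) : Prop :=
  ∀ x ∈ M, ∃ (W : Set (Euc n)) (φ : Euc n → ℝ), (x : Euc n) ∈ W ∧ IsLocalDefining M W φ

/-- The unit normal field, tangent to the sphere, of the hypersurface of `S^n` defined by `φ`. -/
def unitNormal {n : ℕ} (φ : Euc n → ℝ) (y : Euc n) : Euc n :=
  ‖tanGrad φ y‖⁻¹ • tanGrad φ y

/-- The tangent space at `x` of the hypersurface of `S^n` defined by `φ`. -/
def hyperTangent {n : ℕ} (φ : Euc n → ℝ) (x : Euc n) : Submodule ℝ (Euc n) :=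
  (Submodule.span ℝ {x, unitNormal φ x})ᗮ

/-- The (unnormalized) mean curvature in `S^n` at `x` of the hypersurface defined by `φ`: the trace
of the shape operator `v ↦ -∇_v ν`, where `ν` is the unit normal field. -/
def meanCurvature {n : ℕ} (φ : Euc n → ℝ) (x : Euc n) : ℝ :=
  -traceDeriv (hyperTangent φ x) (unitNormal φ) x

/-- `M` is a minimal hypersurface of `S^n`: a smooth embedded submanifold of codimension one whose
mean curvature vanishes at every point (up to sign, the mean curvature does not depend on the
local defining function). -/
def IsMinimalHypersurface {n : ℕ} (M : Set (Sph n)) : Prop :=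
  IsHypersurface M ∧
    ∀ x ∈ M, ∀ (W : Set (Euc n)) (φ : Euc n → ℝ), (x : Euc n) ∈ W → IsLocalDefining M W φ →
      meanCurvature φ x = 0

/-! ### Polynomial maps, lines and Hessians -/

/-- The map `ℝ^{n+1} → ℂ` given by a polynomial with complex coefficients. -/
def polyMap {n : ℕ} (F : MvPolynomial (Fin (n + 1)) ℂ) (x : Euc n) : ℂ :=
  MvPolynomial.eval (fun i => (x i : ℂ)) F

/-- The map `F` is a submersion at `x`. -/
def IsSubmersiveAt {n : ℕ} (F : Euc n → ℂ) (x : Euc n) : Prop :=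
  Function.Surjective (fderiv ℝ F x)

/-- The line `a u + b v = 0` in the plane of complex numbers `u + i v`. -/
def line (a b : ℝ) : Set ℂ := {w | a * w.re + b * w.im = 0}

/-- The function `a Re F + b Im F`. -/
def linComb {n : ℕ} (a b : ℝ) (F : Euc n → ℂ) (x : Euc n) : ℝ :=
  a * (F x).re + b * (F x).im

/-- The Hessian of a function on `ℝ^{n+1}`. -/
def hess {n : ℕ} (P : Euc n → ℝ) (x v w : Euc n) : ℝ :=
  fderiv ℝ (fderiv ℝ P) x v w

end

end SphereEigen

namespace SphereEigen

open Filter Topology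

/-! ### Traces over orthogonal complements -/

/-! Write `P = a Re F + b Im F`, homogeneous of degree `k`. By Euler's identity `⟪grad P, x⟫ = k P`,
so at a zero of `P` on the sphere `grad P` is already tangent to the sphere. Where it is nonzero,
the unit normal of the zero set is `ν = grad P / ‖grad P‖`, and the mean curvature is a nonzero
multiple of `ΔP - Hess P(x, x) - Hess P(ν, ν)`, with `Δ` the Euclidean Laplacian. Euler again gives
`Hess P(x, x) = k (k - 1) P = 0`, so once `ΔP = 0` is known, minimality at `x` says `Hess P(grad P,
grad P) = 0` (`meanCurvature_linComb_eq_zero_iff`).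

Each eigenfunction equation has one role. The Laplace equation gives `ΔF = c F` on the sphere with
`c = λ + k (n + k - 1)`. Here `c` must be real (`im_eq_zero_of_normSq_mul_polyLaplacian`), so `ΔP =
c P = 0` on the zeros of `P`. The gradient equation makes `grad Re F` and `grad Im F` orthogonal of
equal length at the zeros of `F`. Together with Euler's identity at the other points of the line,
this shows that on the zeros of `P` in the sphere `F` is a submersion exactly where `grad P ≠ 0`
(`isSubmersiveAt_of_gradient_ne_zero`).

Two reductions remain: minimality may be tested with the single defining function `P`
(`IsLocalDefining.meanCurvature_eq_zero`), and by homogeneity the Hessian condition on the cone may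
be tested at regular points of the sphere (`forall_hess_eq_zero_iff`). -/

/-- The trace over `K` of a derivative is the trace of the derivative precomposed with the
orthogonal projection to `K`. -/
theorem traceDeriv_eq_trace {n : ℕ} (K : Submodule ℝ (Euc n)) (V : Euc n → Euc n) (x : Euc n) :
    traceDeriv K V x =
      LinearMap.trace ℝ (Euc n) ((fderiv ℝ V x).toLinearMap ∘ₗ K.starProjection.toLinearMap) := by
  have h1 : (fderiv ℝ V x).toLinearMap ∘ₗ K.starProjection.toLinearMap =
      ((fderiv ℝ V x).toLinearMap ∘ₗ K.subtype) ∘ₗ K.orthogonalProjectionOnto.toLinearMap := by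
    rfl
  rw [h1, LinearMap.trace_comp_comm',
    LinearMap.trace_eq_sum_inner _ (stdOrthonormalBasis ℝ K), traceDeriv]
  refine Finset.sum_congr rfl fun i _ => ?_
  rw [real_inner_comm, Submodule.coe_inner]
  change _ = inner ℝ _ (K.orthogonalProjectionOnto
    (fderiv ℝ V x (stdOrthonormalBasis ℝ K i : Euc n)) : Euc n)
  rw [← Submodule.starProjection_apply, ← Submodule.inner_starProjection_left_eq_right,
    Submodule.starProjection_eq_self_iff.mpr (Subtype.mem _)]

/-- Only the quadratic form `v ↦ ⟪D V_x v, v⟫` on `K` enters the trace. This permits discarding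
every term of the derivative that is orthogonal to `v`. -/
theorem traceDeriv_congr {n : ℕ} {K : Submodule ℝ (Euc n)} {V W : Euc n → Euc n} {x : Euc n}
    {c : ℝ} (h : ∀ v ∈ K, inner ℝ (fderiv ℝ V x v) v = c * inner ℝ (fderiv ℝ W x v) v) :
    traceDeriv K V x = c * traceDeriv K W x := by
  rw [traceDeriv, traceDeriv, Finset.mul_sum]
  exact Finset.sum_congr rfl fun i _ => h _ (Subtype.mem _)

/-- The projection to `x^⊥` is `w - ⟪x, w⟫ x`; expanding `⟪x, D V x⟫` in an orthonormal basis lets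
both sides be compared summand by summand. -/
theorem traceDeriv_orthogonal_singleton {n : ℕ} {x : Euc n} (hx : ‖x‖ = 1)
    (V : Euc n → Euc n) (y : Euc n) :
    traceDeriv ((ℝ ∙ x)ᗮ) V y =
      LinearMap.trace ℝ (Euc n) (fderiv ℝ V y).toLinearMap - inner ℝ x (fderiv ℝ V y x) := by
  have hK : ∀ w, ((ℝ ∙ x)ᗮ).starProjection w = w - (inner ℝ x w : ℝ) • x := fun w => by
    rw [Submodule.starProjection_orthogonal_val, Submodule.starProjection_unit_singleton ℝ hx]
  have b := EuclideanSpace.basisFun (Fin (n + 1)) ℝ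
  rw [traceDeriv_eq_trace, LinearMap.trace_eq_sum_inner _ b, LinearMap.trace_eq_sum_inner _ b,
    ← b.sum_inner_mul_inner x, ← Finset.sum_sub_distrib]
  refine Finset.sum_congr rfl fun i _ => ?_
  simp [hK, inner_sub_right, inner_smul_right]

theorem traceDeriv_orthogonal_pair {n : ℕ} {x u : Euc n} (hx : ‖x‖ = 1) (hu : ‖u‖ = 1)
    (hxu : inner ℝ x u = 0) (V : Euc n → Euc n) (y : Euc n) :
    traceDeriv ((Submodule.span ℝ {x, u})ᗮ) V y =
      LinearMap.trace ℝ (Euc n) (fderiv ℝ V y).toLinearMap - inner ℝ x (fderiv ℝ V y x)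
        - inner ℝ u (fderiv ℝ V y u) := by
  have hxx : inner ℝ x x = (1 : ℝ) := by rw [real_inner_self_eq_norm_sq, hx, one_pow]
  have huu : inner ℝ u u = (1 : ℝ) := by rw [real_inner_self_eq_norm_sq, hu, one_pow]
  have hux : inner ℝ u x = (0 : ℝ) := by rw [real_inner_comm, hxu]
  have hK : ∀ w, ((Submodule.span ℝ {x, u})ᗮ).starProjection w =
      w - (inner ℝ x w : ℝ) • x - (inner ℝ u w : ℝ) • u := fun w => by
    rw [Submodule.starProjection_orthogonal_val, sub_sub, sub_right_inj]
    refine Submodule.eq_starProjection_of_mem_orthogonal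
      (Submodule.mem_span_pair.mpr ⟨_, _, rfl⟩) ?_
    rw [Submodule.mem_orthogonal]
    intro z hz
    obtain ⟨p, q, rfl⟩ := Submodule.mem_span_pair.mp hz
    simp only [inner_sub_right, inner_add_right, inner_add_left, inner_smul_left,
      inner_smul_right, hxx, huu, hxu, hux, conj_trivial]
    ring
  have b := EuclideanSpace.basisFun (Fin (n + 1)) ℝ
  rw [traceDeriv_eq_trace, LinearMap.trace_eq_sum_inner _ b, LinearMap.trace_eq_sum_inner _ b,
    ← b.sum_inner_mul_inner x, ← b.sum_inner_mul_inner u, ← Finset.sum_sub_distrib,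
    ← Finset.sum_sub_distrib]
  refine Finset.sum_congr rfl fun i _ => ?_
  simp [hK, inner_sub_right, inner_smul_right]

/-! ### Hypersurfaces of the sphere and their defining functions -/

theorem inner_tanGrad_self_point {n : ℕ} (φ : Euc n → ℝ) {y : Euc n} (hy : ‖y‖ = 1) :
    inner ℝ (tanGrad φ y) y = (0 : ℝ) := by
  rw [tanGrad, inner_sub_left, inner_smul_left, real_inner_self_eq_norm_sq, hy]
  simp

theorem inner_tanGrad_of_orthogonal {n : ℕ} (φ : Euc n → ℝ) {y v : Euc n}
    (hv : inner ℝ y v = (0 : ℝ)) : inner ℝ (tanGrad φ y) v = fderiv ℝ φ y v := by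
  rw [tanGrad, inner_sub_left, inner_smul_left, hv, inner_gradient_left]
  simp

theorem _root_.ContDiffAt.gradient_real {n : ℕ} {φ : Euc n → ℝ} {y : Euc n}
    (h : ContDiffAt ℝ ∞ φ y) : ContDiffAt ℝ ∞ (gradient φ) y :=
  (InnerProductSpace.toDual ℝ (Euc n)).symm.contDiff.contDiffAt.comp y
    (h.fderiv_right (m := ∞) (by simp))

theorem _root_.ContDiffAt.tanGrad {n : ℕ} {φ : Euc n → ℝ} {y : Euc n}
    (h : ContDiffAt ℝ ∞ φ y) : ContDiffAt ℝ ∞ (tanGrad φ) y :=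
  h.gradient_real.sub ((h.gradient_real.inner ℝ contDiffAt_id).smul contDiffAt_id)

theorem IsLocalDefining.contDiffAt {n : ℕ} {M : Set (Sph n)} {W : Set (Euc n)} {φ : Euc n → ℝ}
    (h : IsLocalDefining M W φ) {y : Euc n} (hy : y ∈ W) : ContDiffAt ℝ ∞ φ y :=
  h.smooth.contDiffAt (h.isOpen.mem_nhds hy)

/-- Every vector tangent to the sphere and to the level set of `ψ` is the velocity of a curve in
the intersection of the two. -/
theorem exists_curve {n : ℕ} {ψ : Euc n → ℝ} {x v : Euc n} (hψ : ContDiffAt ℝ ∞ ψ x)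
    (hx : ‖x‖ = 1) (h0 : ψ x = 0) (hreg : tanGrad ψ x ≠ 0) (hxv : inner ℝ x v = (0 : ℝ))
    (hv : fderiv ℝ ψ x v = 0) :
    ∃ γ : ℝ → Euc n, γ 0 = x ∧ HasDerivAt γ v 0 ∧ ∀ᶠ t in 𝓝 0, ‖γ t‖ = 1 ∧ ψ (γ t) = 0 := by
  -- Implicit function theorem for `y ↦ (‖y‖ ^ 2, ψ y)`, whose level set through `x` is the
  -- intersection of the sphere with `ψ = 0`.
  obtain ⟨L, hL₁, hL₂, hs⟩ : ∃ L : Euc n →L[ℝ] ℝ × ℝ, (∀ u, (L u).1 = 2 * inner ℝ x u) ∧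
      (∀ u, (L u).2 = fderiv ℝ ψ x u) ∧
      HasStrictFDerivAt (fun y : Euc n => (‖y‖ ^ 2, ψ y)) L x :=
    ⟨_, fun u => by simp, fun u => rfl,
      (hasStrictFDerivAt_norm_sq x).prodMk (hψ.hasStrictFDerivAt (by simp))⟩
  have hxx : inner ℝ x x = (1 : ℝ) := by rw [real_inner_self_eq_norm_sq, hx, one_pow]
  have hxt : inner ℝ x (tanGrad ψ x) = (0 : ℝ) := by
    rw [real_inner_comm, inner_tanGrad_self_point ψ hx]
  have htt : fderiv ℝ ψ x (tanGrad ψ x) ≠ 0 := by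
    rw [← inner_tanGrad_of_orthogonal ψ hxt]
    simpa using hreg
  have hr : L.range = ⊤ := by
    rw [LinearMap.range_eq_top]
    rintro ⟨p, q⟩
    -- The multiple of `x` produces the first coordinate; `tanGrad ψ x`, which does not affect it,
    -- corrects the second.
    refine ⟨(p / 2) • x + ((q - p / 2 * fderiv ℝ ψ x x) / fderiv ℝ ψ x (tanGrad ψ x)) •
      tanGrad ψ x, Prod.ext ?_ ?_⟩
    · rw [ContinuousLinearMap.coe_coe, hL₁]
      simp only [inner_add_right, inner_smul_right, hxx, hxt]
      ring
    · rw [ContinuousLinearMap.coe_coe, hL₂]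
      simp only [map_add, map_smul, smul_eq_mul]
      field_simp
      ring
  obtain ⟨w, hwv⟩ : ∃ w : L.ker, (w : Euc n) = v :=
    ⟨⟨v, by
      rw [LinearMap.mem_ker]
      exact Prod.ext ((hL₁ v).trans (by rw [hxv, mul_zero]; rfl)) ((hL₂ v).trans hv)⟩, rfl⟩
  have hw : HasDerivAt (fun t : ℝ => t • w) w 0 := by
    have := (hasDerivAt_id (0 : ℝ)).smul_const w
    rwa [one_smul] at this
  refine ⟨fun t => hs.implicitFunction _ _ hr (‖x‖ ^ 2, ψ x) (t • w), ?_, ?_, ?_⟩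
  · beta_reduce
    rw [zero_smul]
    exact hs.implicitFunction_apply_image hr
  · have h1 := hs.to_implicitFunction hr
    rw [← hwv]
    exact HasFDerivAt.comp_hasDerivAt (0 : ℝ) (f := fun t : ℝ => t • w)
      (by rw [zero_smul]; exact h1.hasFDerivAt) hw
  · have h1 := hs.map_implicitFunction_eq hr
    have h2 : Tendsto (fun t : ℝ => ((‖x‖ ^ 2, ψ x), t • w)) (𝓝 0) (𝓝 ((‖x‖ ^ 2, ψ x), 0)) := by
      refine (tendsto_const_nhds).prodMk_nhds ?_
      have := hw.continuousAt.tendsto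
      rwa [zero_smul] at this
    filter_upwards [h2.eventually h1] with t ht
    obtain ⟨h3, h4⟩ := Prod.ext_iff.mp ht
    refine ⟨?_, h4.trans h0⟩
    exact (pow_left_inj₀ (norm_nonneg _) zero_le_one two_ne_zero).mp
      (h3.trans (by rw [hx]))

/-- A curve in `M` with a prescribed tangent vector as velocity. -/
theorem IsLocalDefining.exists_curve {n : ℕ} {M : Set (Sph n)} {W : Set (Euc n)} {ψ : Euc n → ℝ}
    (h : IsLocalDefining M W ψ) {x : Sph n} (hxW : (x : Euc n) ∈ W) (hxM : x ∈ M) {v : Euc n}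
    (hxv : inner ℝ (x : Euc n) v = (0 : ℝ)) (hv : inner ℝ (tanGrad ψ x) v = (0 : ℝ)) :
    ∃ γ : ℝ → Euc n, γ 0 = x ∧ HasDerivAt γ v 0 ∧ ∀ᶠ t in 𝓝 0, ∃ y ∈ M, γ t = (y : Euc n) := by
  obtain ⟨γ, h0, hd, he⟩ := SphereEigen.exists_curve (h.contDiffAt hxW)
    (mem_sphere_zero_iff_norm.mp x.2) ((h.mem_iff x hxW).mp hxM) (h.regular x hxW hxM) hxv
    (by rwa [← inner_tanGrad_of_orthogonal ψ hxv])
  refine ⟨γ, h0, hd, ?_⟩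
  have hW : ∀ᶠ t in 𝓝 0, γ t ∈ W :=
    hd.continuousAt.eventually_mem (by rw [h0]; exact h.isOpen.mem_nhds hxW)
  filter_upwards [he, hW] with t ht htW
  exact ⟨⟨γ t, mem_sphere_zero_iff_norm.mpr ht.1⟩, (h.mem_iff ⟨γ t, _⟩ htW).mpr ht.2, rfl⟩

/-- The tangential gradients of two local defining functions are parallel. -/
theorem IsLocalDefining.parallel {n : ℕ} {M : Set (Sph n)} {W W' : Set (Euc n)}
    {φ ψ : Euc n → ℝ} (hφ : IsLocalDefining M W φ) (hψ : IsLocalDefining M W' ψ) {y : Sph n}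
    (hy : y ∈ M) (hW : (y : Euc n) ∈ W) (hW' : (y : Euc n) ∈ W') :
    (inner ℝ (tanGrad ψ y) (tanGrad ψ y) : ℝ) • tanGrad φ y =
      (inner ℝ (tanGrad φ y) (tanGrad ψ y) : ℝ) • tanGrad ψ y := by
  have hn := mem_sphere_zero_iff_norm.mp y.2
  set f := tanGrad φ y with hf
  set g := tanGrad ψ y with hg
  -- Up to the factor `‖g‖ ^ 2`, `v` is the part of `f` orthogonal to `g`. It is the velocity of a
  -- curve in `M`, along which `φ` vanishes, so `v` is orthogonal to `f` too, hence to itself.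
  set v : Euc n := (inner ℝ g g : ℝ) • f - (inner ℝ f g : ℝ) • g with hv
  have hfy : inner ℝ (y : Euc n) f = (0 : ℝ) := by
    rw [real_inner_comm]; exact inner_tanGrad_self_point φ hn
  have hgy : inner ℝ (y : Euc n) g = (0 : ℝ) := by
    rw [real_inner_comm]; exact inner_tanGrad_self_point ψ hn
  have hyv : inner ℝ (y : Euc n) v = (0 : ℝ) := by
    simp [hv, inner_sub_right, inner_smul_right, hfy, hgy]
  have hgv : inner ℝ g v = (0 : ℝ) := by
    rw [hv, inner_sub_right, inner_smul_right, inner_smul_right, real_inner_comm f g]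
    ring
  obtain ⟨γ, h0, hd, he⟩ := hψ.exists_curve hW' hy hyv hgv
  have hγW : ∀ᶠ t in 𝓝 0, γ t ∈ W :=
    hd.continuousAt.eventually_mem (by rw [h0]; exact hφ.isOpen.mem_nhds hW)
  have hzero : (fun t => φ (γ t)) =ᶠ[𝓝 0] fun _ => 0 := by
    filter_upwards [he, hγW] with t ⟨z, hz, hzt⟩ htW
    rw [hzt] at htW ⊢
    exact (hφ.mem_iff z htW).mp hz
  have hfd : HasFDerivAt φ (fderiv ℝ φ y) (γ 0) := by
    rw [h0]
    exact ((hφ.contDiffAt hW).differentiableAt (by simp)).hasFDerivAt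
  have hfv : inner ℝ f v = (0 : ℝ) := by
    rw [hf, inner_tanGrad_of_orthogonal φ hyv]
    exact (hfd.comp_hasDerivAt 0 hd).unique ((hasDerivAt_const 0 0).congr_of_eventuallyEq hzero)
  have hvv : inner ℝ v v = (0 : ℝ) := by
    nth_rw 1 [hv]
    rw [inner_sub_left, inner_smul_left, inner_smul_left, hfv, hgv]
    simp
  exact sub_eq_zero.mp (inner_self_eq_zero.mp hvv)

/-- In the mean curvature the normalization of the normal field only contributes a factor. -/
theorem meanCurvature_eq {n : ℕ} {φ : Euc n → ℝ} {x : Euc n} (hφ : ContDiffAt ℝ ∞ φ x)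
    (hreg : tanGrad φ x ≠ 0) :
    meanCurvature φ x = -(‖tanGrad φ x‖⁻¹ * traceDeriv (hyperTangent φ x) (tanGrad φ) x) := by
  rw [meanCurvature, traceDeriv_congr]
  intro v hv
  have hd : DifferentiableAt ℝ (tanGrad φ) x := hφ.tanGrad.differentiableAt (by simp)
  have hdn : DifferentiableAt ℝ (fun y => ‖tanGrad φ y‖⁻¹) x :=
    (hd.norm ℝ hreg).inv (norm_ne_zero_iff.mpr hreg)
  have hv2 : inner ℝ (unitNormal φ x) v = (0 : ℝ) :=
    (Submodule.mem_orthogonal _ v).mp hv _ (Submodule.subset_span (by simp))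
  have hv3 : inner ℝ (tanGrad φ x) v = (0 : ℝ) := by
    rw [unitNormal, inner_smul_left] at hv2
    exact (mul_eq_zero.mp hv2).resolve_left (by simpa using hreg)
  -- The product rule term differentiating the norm is a multiple of `tanGrad φ x`, which is
  -- orthogonal to `v`.
  have : fderiv ℝ (unitNormal φ) x = _ := fderiv_fun_smul hdn hd
  rw [this]
  simp [inner_add_left, inner_smul_left, hv3]

/-- Whether the mean curvature vanishes does not depend on the local defining function. -/
theorem IsLocalDefining.meanCurvature_eq_zero {n : ℕ} {M : Set (Sph n)} {W W' : Set (Euc n)}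
    {φ ψ : Euc n → ℝ} (hφ : IsLocalDefining M W φ) (hψ : IsLocalDefining M W' ψ) {x : Sph n}
    (hx : x ∈ M) (hW : (x : Euc n) ∈ W) (hW' : (x : Euc n) ∈ W')
    (h : meanCurvature ψ x = 0) : meanCurvature φ x = 0 := by
  have hn := mem_sphere_zero_iff_norm.mp x.2
  have hfr := hφ.regular x hW hx
  have hgr := hψ.regular x hW' hx
  have hfd : DifferentiableAt ℝ (tanGrad φ) x :=
    (hφ.contDiffAt hW).tanGrad.differentiableAt (by simp)
  have hgd : DifferentiableAt ℝ (tanGrad ψ) x :=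
    (hψ.contDiffAt hW').tanGrad.differentiableAt (by simp)
  have hpar := hφ.parallel hψ hx hW hW'
  have hgg : (inner ℝ (tanGrad ψ x) (tanGrad ψ x) : ℝ) ≠ 0 := inner_self_ne_zero.mpr hgr
  have hfg : (inner ℝ (tanGrad φ x) (tanGrad ψ x) : ℝ) ≠ 0 := by
    intro h0
    rw [h0, zero_smul] at hpar
    exact (smul_ne_zero hgg hfr) hpar
  have hmem : ∀ {χ : Euc n → ℝ}, tanGrad χ x ≠ 0 → ∀ v, v ∈ hyperTangent χ x ↔
      inner ℝ (x : Euc n) v = (0 : ℝ) ∧ inner ℝ (tanGrad χ x) v = (0 : ℝ) := by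
    intro χ hχ v
    have h1 : (inner ℝ (unitNormal χ x) v : ℝ) = 0 ↔ (inner ℝ (tanGrad χ x) v : ℝ) = 0 := by
      rw [unitNormal, inner_smul_left]
      simp [hχ]
    rw [← h1, hyperTangent, Submodule.mem_orthogonal]
    constructor
    · intro h
      exact ⟨h _ (Submodule.subset_span (by simp)), h _ (Submodule.subset_span (by simp))⟩
    · rintro ⟨h2, h3⟩ u hu
      obtain ⟨p, q, rfl⟩ := Submodule.mem_span_pair.mp hu
      simp [inner_add_left, inner_smul_left, h2, h3]
  have hK : hyperTangent φ x = hyperTangent ψ x := by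
    ext v
    rw [hmem hfr, hmem hgr]
    refine and_congr_right fun _ => ?_
    have := congrArg (fun u => (inner ℝ u v : ℝ)) hpar
    simp only [inner_smul_left, conj_trivial] at this
    constructor
    · intro h0
      rw [h0, mul_zero] at this
      exact (mul_eq_zero.mp this.symm).resolve_left hfg
    · intro h0
      rw [h0, mul_zero] at this
      exact (mul_eq_zero.mp this).resolve_left hgg
  -- The identity of `parallel` is differentiated along a curve in `M` with velocity `v` and paired
  -- with `v`; the derivatives of the coefficients multiply vectors orthogonal to `v` and drop out.
  have key : traceDeriv (hyperTangent φ x) (tanGrad φ) x =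
      (inner ℝ (tanGrad φ x) (tanGrad ψ x) / inner ℝ (tanGrad ψ x) (tanGrad ψ x) : ℝ) *
        traceDeriv (hyperTangent φ x) (tanGrad ψ) x := by
    refine traceDeriv_congr fun v hv => ?_
    have hfv := ((hmem hfr v).mp hv).2
    obtain ⟨hxv, hgv⟩ := (hmem hgr v).mp (hK ▸ hv)
    obtain ⟨γ, h0, hd, he⟩ := hψ.exists_curve hW' hx hxv hgv
    have hγW : ∀ᶠ t in 𝓝 0, γ t ∈ W :=
      hd.continuousAt.eventually_mem (by rw [h0]; exact hφ.isOpen.mem_nhds hW)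
    have hγW' : ∀ᶠ t in 𝓝 0, γ t ∈ W' :=
      hd.continuousAt.eventually_mem (by rw [h0]; exact hψ.isOpen.mem_nhds hW')
    have hf' : HasDerivAt (fun t => tanGrad φ (γ t)) (fderiv ℝ (tanGrad φ) x v) 0 :=
      HasFDerivAt.comp_hasDerivAt (l := tanGrad φ) 0 (by rw [h0]; exact hfd.hasFDerivAt) hd
    have hg' : HasDerivAt (fun t => tanGrad ψ (γ t)) (fderiv ℝ (tanGrad ψ) x v) 0 :=
      HasFDerivAt.comp_hasDerivAt (l := tanGrad ψ) 0 (by rw [h0]; exact hgd.hasFDerivAt) hd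
    have hl := (((hg'.inner ℝ hg').smul hf').inner ℝ (hasDerivAt_const 0 v))
    have hr := (((hf'.inner ℝ hg').smul hg').inner ℝ (hasDerivAt_const 0 v))
    have heq : (fun t => (inner ℝ ((inner ℝ (tanGrad ψ (γ t)) (tanGrad ψ (γ t)) : ℝ) •
        tanGrad φ (γ t)) v : ℝ)) =ᶠ[𝓝 0] fun t => (inner ℝ ((inner ℝ (tanGrad φ (γ t))
        (tanGrad ψ (γ t)) : ℝ) • tanGrad ψ (γ t)) v : ℝ) := by
      filter_upwards [he, hγW, hγW'] with t ⟨z, hz, hzt⟩ ht ht'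
      rw [hzt] at ht ht' ⊢
      rw [hφ.parallel hψ hz ht ht']
    have hu := hl.unique (hr.congr_of_eventuallyEq heq)
    simp only [h0, inner_add_left, inner_smul_left, hfv, hgv, inner_zero_right, conj_trivial,
      mul_zero, add_zero, zero_add] at hu
    field_simp
    linarith
  have hz : traceDeriv (hyperTangent φ x) (tanGrad ψ) x = 0 := by
    rw [meanCurvature_eq (hψ.contDiffAt hW') hgr, neg_eq_zero, mul_eq_zero] at h
    rw [hK]
    exact h.resolve_left (by simpa using hgr)
  rw [meanCurvature_eq (hφ.contDiffAt hW) hfr, key, hz]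
  simp

end SphereEigen
namespace SphereEigen

open Filter Topology MvPolynomial

/-! ### The Laplacian of polynomials -/

section Laplacian

variable {σ R : Type*} [CommRing R]

theorem pderiv_eq_zero_of_isHomogeneous_zero {F : MvPolynomial σ R} (hF : F.IsHomogeneous 0)
    (i : σ) : pderiv i F = 0 := by
  rw [totalDegree_eq_zero_iff_eq_C.mp (Nat.le_zero.mp hF.totalDegree_le), pderiv_C]

theorem pderiv_pderiv_eq_zero {F : MvPolynomial σ R} {k : ℕ} (hF : F.IsHomogeneous k)
    (hk : k ≤ 1) (i j : σ) : pderiv i (pderiv j F) = 0 :=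
  pderiv_eq_zero_of_isHomogeneous_zero (by simpa [Nat.sub_eq_zero_of_le hk] using hF.pderiv) i

variable [Fintype σ]

/-- The Euclidean Laplacian of a polynomial. -/
noncomputable def polyLaplacian (F : MvPolynomial σ R) : MvPolynomial σ R :=
  ∑ i, pderiv i (pderiv i F)

theorem polyLaplacian_eq_zero {F : MvPolynomial σ R} {k : ℕ} (hF : F.IsHomogeneous k)
    (hk : k ≤ 1) : polyLaplacian F = 0 :=
  Finset.sum_eq_zero fun i _ => pderiv_pderiv_eq_zero hF hk i i

theorem isHomogeneous_polyLaplacian {F : MvPolynomial σ R} {k : ℕ}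
    (hF : F.IsHomogeneous k) : (polyLaplacian F).IsHomogeneous (k - 1 - 1) :=
  IsHomogeneous.sum _ _ _ fun _ _ => hF.pderiv.pderiv

theorem polyLaplacian_C_mul (c : R) (F : MvPolynomial σ R) :
    polyLaplacian (C c * F) = C c * polyLaplacian F := by
  simp [polyLaplacian, Finset.mul_sum]

/-- With `N` variables, `Δ r² = 2N`, and the cross term `2 ∇r² · ∇H = 4 ∑ X i ∂ᵢH` equals `4 m H` by
Euler. -/
theorem polyLaplacian_normSq_mul {H : MvPolynomial σ R} {m : ℕ} (hH : H.IsHomogeneous m) :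
    polyLaplacian ((∑ i, X i ^ 2) * H) =
      C ((2 * Fintype.card σ + 4 * m : ℕ) : R) * H + (∑ i, X i ^ 2) * polyLaplacian H := by
  classical
  have hX : ∀ i : σ, pderiv i (∑ j, X j ^ 2 : MvPolynomial σ R) = 2 * X i := fun i => by
    rw [map_sum, Finset.sum_eq_single i]
    · rw [pderiv_pow, pderiv_X_self]; simp
    · intro j _ hj
      rw [pderiv_pow, pderiv_X_of_ne hj, mul_zero]
    · simp
  have h2 : ∀ i : σ, pderiv i (2 * X i : MvPolynomial σ R) = 2 := fun i => by
    rw [two_mul, map_add, pderiv_X_self]; norm_num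
  have hi : ∀ i : σ, pderiv i (pderiv i ((∑ j, X j ^ 2) * H)) =
      2 * H + 4 * (X i * pderiv i H) + (∑ j, X j ^ 2) * pderiv i (pderiv i H) := fun i => by
    rw [pderiv_mul, hX, map_add, pderiv_mul, h2, pderiv_mul, hX]
    ring
  rw [polyLaplacian, Finset.sum_congr rfl fun i _ => hi i, Finset.sum_add_distrib,
    Finset.sum_add_distrib, ← Finset.mul_sum, ← Finset.mul_sum, hH.sum_X_mul_pderiv, polyLaplacian,
    map_natCast]
  simp only [Finset.sum_const, Finset.card_univ, nsmul_eq_mul, Finset.mul_sum _ _ (∑ i, X i ^ 2)]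
  push_cast
  ring

end Laplacian

/-- If `r² Δ F = c F` for a nonzero homogeneous polynomial `F`, then `c` is real. -/
theorem im_eq_zero_of_normSq_mul_polyLaplacian {σ : Type*} [Fintype σ] (k : ℕ) :
    ∀ (F : MvPolynomial σ ℂ) (c : ℂ), F.IsHomogeneous k → F ≠ 0 →
      (∑ i, X i ^ 2) * polyLaplacian F = C c * F → c.im = 0 := by
  induction k using Nat.strong_induction_on with
  | _ k ih =>
    intro F c hF h0 h
    by_cases hL : polyLaplacian F = 0
    · rw [hL, mul_zero, eq_comm, mul_eq_zero, C_eq_zero] at h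
      rw [h.resolve_right h0, Complex.zero_im]
    · have hk : 2 ≤ k := by
        by_contra hk
        exact hL (polyLaplacian_eq_zero hF (by omega))
      have hH := isHomogeneous_polyLaplacian hF
      -- Applying `Δ` to `r² H = c F`, with `H = ΔF`, gives `r² ΔH = (c - 2N - 4(k - 2)) H`: the
      -- same relation in lower degree, with `c` shifted by a real number.
      have h1 := congrArg polyLaplacian h
      rw [polyLaplacian_normSq_mul hH, polyLaplacian_C_mul] at h1
      have h2 := ih _ (by omega) _ (c - ((2 * Fintype.card σ + 4 * (k - 1 - 1) : ℕ) : ℂ)) hH hL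
        (by rw [C_sub, sub_mul]; exact eq_sub_of_add_eq' h1)
      simpa using h2

/-! ### Calculus of polynomial maps -/

theorem polyMap_smul {n k : ℕ} {F : MvPolynomial (Fin (n + 1)) ℂ} (hF : F.IsHomogeneous k)
    (t : ℝ) (x : Euc n) : polyMap F (t • x) = (t : ℂ) ^ k * polyMap F x := by
  have h1 : (fun i => (((t • x) i : ℝ) : ℂ)) = fun i => (t : ℂ) * (x i : ℂ) := by
    ext i; simp
  rw [polyMap, polyMap, h1, eval_eq', eval_eq', Finset.mul_sum]
  refine Finset.sum_congr rfl fun d hd => ?_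
  have hdeg : ∑ i, d i = k := by
    have := hF (mem_support_iff.mp hd)
    simpa [Finsupp.weight_apply, Finsupp.sum_fintype] using this
  simp_rw [mul_pow, Finset.prod_mul_distrib, Finset.prod_pow_eq_pow_sum, hdeg]
  ring

theorem hasFDerivAt_polyMap {n : ℕ} (F : MvPolynomial (Fin (n + 1)) ℂ) (x : Euc n) :
    HasFDerivAt (polyMap F) (∑ i, (EuclideanSpace.proj i : Euc n →L[ℝ] ℝ).smulRight
      (polyMap (pderiv i F) x)) x := by
  classical
  induction F using MvPolynomial.induction_on with
  | C c =>
    have h1 : polyMap (n := n) (C c) = fun _ => c := by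
      ext y; simp [polyMap]
    rw [h1]
    refine (hasFDerivAt_const c x).congr_fderiv ?_
    ext v; simp [polyMap]
  | add p q hp hq =>
    have h1 : polyMap (n := n) (p + q) = fun y => polyMap p y + polyMap q y := by
      ext y; simp [polyMap]
    rw [h1]
    refine (hp.fun_add hq).congr_fderiv ?_
    ext v; simp [polyMap, Finset.sum_add_distrib]
  | mul_X p j hp =>
    have h1 : polyMap (n := n) (p * X j) = fun y => polyMap p y * ((y j : ℝ) : ℂ) := by
      ext y; simp [polyMap]
    have hj : HasFDerivAt (fun y : Euc n => ((y j : ℝ) : ℂ))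
        (Complex.ofRealCLM.comp (EuclideanSpace.proj j : Euc n →L[ℝ] ℝ)) x :=
      (Complex.ofRealCLM.comp (EuclideanSpace.proj j : Euc n →L[ℝ] ℝ)).hasFDerivAt
    rw [h1]
    refine (hp.fun_mul hj).congr_fderiv ?_
    ext v
    simp [polyMap, pderiv_X, Finset.sum_add_distrib, Pi.single_apply,
      Finset.mul_sum, apply_ite, mul_comm, mul_left_comm]

theorem contDiff_polyMap {n : ℕ} (F : MvPolynomial (Fin (n + 1)) ℂ) :
    ContDiff ℝ ∞ (polyMap (n := n) F) := by
  induction F using MvPolynomial.induction_on with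
  | C c =>
    have h1 : polyMap (n := n) (C c) = fun _ => c := by
      ext y; simp [polyMap]
    rw [h1]
    exact contDiff_const
  | add p q hp hq =>
    have h1 : polyMap (n := n) (p + q) = fun y => polyMap p y + polyMap q y := by
      ext y; simp [polyMap]
    rw [h1]
    exact hp.add hq
  | mul_X p j hp =>
    have h1 : polyMap (n := n) (p * X j) = fun y => polyMap p y * ((y j : ℝ) : ℂ) := by
      ext y; simp [polyMap]
    rw [h1]
    exact hp.mul (Complex.ofRealCLM.comp (EuclideanSpace.proj j : Euc n →L[ℝ] ℝ)).contDiff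

/-! ### Derivatives of `a Re F + b Im F` and Euler's identities -/

section LinComb

variable {n : ℕ} (a b : ℝ) (F : MvPolynomial (Fin (n + 1)) ℂ)

theorem contDiff_linComb : ContDiff ℝ ∞ (linComb a b (polyMap (n := n) F)) :=
  (contDiff_const.mul (Complex.reCLM.contDiff.comp (contDiff_polyMap F))).add
    (contDiff_const.mul (Complex.imCLM.contDiff.comp (contDiff_polyMap F)))

theorem fderiv_linComb_polyMap (x v : Euc n) :
    fderiv ℝ (linComb a b (polyMap F)) x v = ∑ i, v i * linComb a b (polyMap (pderiv i F)) x := by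
  have h := hasFDerivAt_polyMap F x
  have h1 : HasFDerivAt (linComb a b (polyMap F)) _ x :=
    ((Complex.reCLM.hasFDerivAt.comp x h).const_mul a).add
      ((Complex.imCLM.hasFDerivAt.comp x h).const_mul b)
  rw [h1.fderiv]
  simp [linComb, Finset.mul_sum, mul_add, Finset.sum_add_distrib, mul_left_comm]

theorem gradient_linComb_polyMap_apply (x : Euc n) (i : Fin (n + 1)) :
    gradient (linComb a b (polyMap F)) x i = linComb a b (polyMap (pderiv i F)) x := by
  have h := inner_gradient_left (𝕜 := ℝ) (f := linComb a b (polyMap F)) (x := x)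
    (y := EuclideanSpace.single i (1 : ℝ))
  rw [fderiv_linComb_polyMap] at h
  rw [EuclideanSpace.inner_single_right] at h
  simpa [Pi.single_apply] using h

theorem hess_linComb_polyMap (x v w : Euc n) :
    hess (linComb a b (polyMap F)) x v w =
      ∑ j, w j * ∑ i, v i * linComb a b (polyMap (pderiv i (pderiv j F))) x := by
  have hd : DifferentiableAt ℝ (fderiv ℝ (linComb a b (polyMap F))) x :=
    ((contDiff_linComb a b F).fderiv_right (m := ∞) (by simp)).contDiffAt.differentiableAt (by simp)
  have h1 : HasFDerivAt (fun y => fderiv ℝ (linComb a b (polyMap F)) y w) _ x :=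
    hd.hasFDerivAt.clm_apply (hasFDerivAt_const w x)
  have h2 : HasFDerivAt (fun y => ∑ j, w j * linComb a b (polyMap (pderiv j F)) y) _ x :=
    HasFDerivAt.fun_sum fun j _ =>
      (((contDiff_linComb a b (pderiv j F)).contDiffAt (x := x)).differentiableAt
        (by simp)).hasFDerivAt.const_mul (w j)
  have h3 := congrArg (fun L : Euc n →L[ℝ] ℝ => L v) (h1.unique
    (h2.congr_of_eventuallyEq (Eventually.of_forall fun y => fderiv_linComb_polyMap a b F y w)))
  simpa [hess, fderiv_linComb_polyMap] using h3

theorem inner_fderiv_gradient {P : Euc n → ℝ} {x : Euc n} (hP : ContDiffAt ℝ ∞ P x)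
    (v w : Euc n) : inner ℝ (fderiv ℝ (gradient P) x v) w = hess P x v w := by
  have hd : DifferentiableAt ℝ (fderiv ℝ P) x :=
    (hP.fderiv_right (m := ∞) (by simp)).differentiableAt (by simp)
  have hg : DifferentiableAt ℝ (gradient P) x := hP.gradient_real.differentiableAt (by simp)
  have h1 : HasFDerivAt (fun y => fderiv ℝ P y w) _ x :=
    hd.hasFDerivAt.clm_apply (hasFDerivAt_const w x)
  have h2 : HasFDerivAt (fun y => inner ℝ (gradient P y) w) _ x :=
    hg.hasFDerivAt.inner ℝ (hasFDerivAt_const w x)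
  have h3 := congrArg (fun L : Euc n →L[ℝ] ℝ => L v) (h1.unique
    (h2.congr_of_eventuallyEq (Eventually.of_forall fun y => inner_gradient_left.symm)))
  simpa [hess] using h3.symm

theorem linComb_polyMap_sum {ι : Type*} (s : Finset ι) (G : ι → MvPolynomial (Fin (n + 1)) ℂ)
    (x : Euc n) : linComb a b (polyMap (∑ i ∈ s, G i)) x = ∑ i ∈ s, linComb a b (polyMap (G i)) x := by
  simp [linComb, polyMap, Finset.mul_sum, Finset.sum_add_distrib]

theorem trace_fderiv_gradient (x : Euc n) :
    LinearMap.trace ℝ (Euc n) (fderiv ℝ (gradient (linComb a b (polyMap F))) x).toLinearMap =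
      linComb a b (polyMap (polyLaplacian F)) x := by
  rw [LinearMap.trace_eq_sum_inner _ (EuclideanSpace.basisFun (Fin (n + 1)) ℝ), polyLaplacian,
    linComb_polyMap_sum]
  refine Finset.sum_congr rfl fun i _ => ?_
  rw [real_inner_comm, ContinuousLinearMap.coe_coe,
    inner_fderiv_gradient (contDiff_linComb a b F).contDiffAt, hess_linComb_polyMap]
  simp

variable {a b F} {k : ℕ} (hF : F.IsHomogeneous k)
include hF

theorem linComb_polyMap_smul (t : ℝ) (x : Euc n) :
    linComb a b (polyMap F) (t • x) = t ^ k * linComb a b (polyMap F) x := by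
  rw [linComb, linComb, polyMap_smul hF, ← Complex.ofReal_pow, Complex.re_ofReal_mul,
    Complex.im_ofReal_mul]
  ring

theorem sum_mul_polyMap_pderiv (x : Euc n) :
    ∑ i, (x i : ℂ) * polyMap (pderiv i F) x = k * polyMap F x := by
  have h := congrArg (eval fun i => (x i : ℂ)) hF.sum_X_mul_pderiv
  simpa [polyMap] using h

theorem sum_mul_linComb_pderiv (x : Euc n) :
    ∑ i, x i * linComb a b (polyMap (pderiv i F)) x = k * linComb a b (polyMap F) x := by
  have h := sum_mul_polyMap_pderiv hF x
  have hre := congrArg Complex.re h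
  have him := congrArg Complex.im h
  simp only [Complex.re_sum, Complex.im_sum, Complex.re_ofReal_mul, Complex.im_ofReal_mul,
    ← Complex.ofReal_natCast] at hre him
  simp only [linComb, mul_add, Finset.sum_add_distrib, mul_left_comm (_ : ℝ) a,
    mul_left_comm (_ : ℝ) b, ← Finset.mul_sum, hre, him]

theorem inner_gradient_self (x : Euc n) :
    inner ℝ (gradient (linComb a b (polyMap F)) x) x = k * linComb a b (polyMap F) x := by
  rw [inner_gradient_left, fderiv_linComb_polyMap, sum_mul_linComb_pderiv hF]

/-- Euler's identity twice: for the partial derivatives, of degree `k - 1`, then for `F`. Degree `0`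
is separate because `k - 1` truncates. -/
theorem hess_self_self (x : Euc n) :
    hess (linComb a b (polyMap F)) x x x = k * (k - 1) * linComb a b (polyMap F) x := by
  rw [hess_linComb_polyMap]
  rcases Nat.eq_zero_or_pos k with rfl | hk
  · simp [pderiv_pderiv_eq_zero hF, linComb, polyMap]
  · simp_rw [sum_mul_linComb_pderiv hF.pderiv, mul_left_comm (_ : ℝ) ((k - 1 : ℕ) : ℝ),
      ← Finset.mul_sum, sum_mul_linComb_pderiv hF]
    push_cast [hk]
    ring

end LinComb

end SphereEigen
namespace SphereEigen

open Filter Topology MvPolynomial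

/-! ### Gradient and Laplacian of a homogeneous polynomial restricted to the sphere -/

section Restriction

variable {n k : ℕ} {a b : ℝ} {F : MvPolynomial (Fin (n + 1)) ℂ}

theorem rayExtend_linComb (hF : F.IsHomogeneous k) {y : Euc n} (hy : y ≠ 0) :
    rayExtend (fun z : Sph n => linComb a b (polyMap F) z) y =
      ‖y‖⁻¹ ^ k * linComb a b (polyMap F) y := by
  rw [rayExtend, dif_neg hy]
  exact linComb_polyMap_smul hF _ y

theorem hasFDerivAt_norm_inv_pow (k : ℕ) {y : Euc n} (hy : y ≠ 0) :
    HasFDerivAt (fun z : Euc n => ‖z‖⁻¹ ^ k) (-(k * ‖y‖⁻¹ ^ (k + 2)) • innerSL ℝ y) y := by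
  have hn : ‖y‖ ≠ 0 := norm_ne_zero_iff.mpr hy
  have h1 : HasFDerivAt (fun z : Euc n => ‖z‖) (‖y‖⁻¹ • innerSL ℝ y) y := by
    have := (hasStrictFDerivAt_norm_sq y).hasFDerivAt.sqrt (by positivity)
    simp only [Real.sqrt_sq (norm_nonneg _)] at this
    refine this.congr_fderiv ?_
    ext v
    simp
    field_simp
  refine ((hasDerivAt_pow k ‖y‖⁻¹).comp_hasFDerivAt y
    ((hasDerivAt_inv hn).comp_hasFDerivAt y h1)).congr_fderiv ?_
  ext v
  -- The chain rule gives `‖y‖⁻¹` to the power `(k - 1) + 2 + 1`, with `k - 1` truncated at `k = 0`.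
  rcases k with _ | k
  · simp
  · simp
    field_simp
    ring

theorem gradField_linComb (hF : F.IsHomogeneous k) {y : Euc n} (hy : y ≠ 0) :
    gradField (fun z : Sph n => linComb a b (polyMap F) z) y =
      ‖y‖⁻¹ ^ k • gradient (linComb a b (polyMap F)) y -
        (k * ‖y‖⁻¹ ^ (k + 2) * linComb a b (polyMap F) y) • y := by
  have hd : DifferentiableAt ℝ (linComb a b (polyMap F)) y :=
    (contDiff_linComb a b F).contDiffAt.differentiableAt (by simp)
  have h1 := (hasFDerivAt_norm_inv_pow k hy).fun_mul hd.hasFDerivAt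
  have h2 : rayExtend (fun z : Sph n => linComb a b (polyMap F) z) =ᶠ[𝓝 y]
      fun y => ‖y‖⁻¹ ^ k * linComb a b (polyMap F) y := by
    filter_upwards [isOpen_ne.mem_nhds hy] with z hz using rayExtend_linComb hF hz
  refine ext_inner_right ℝ fun v => ?_
  rw [gradField, inner_gradient_left, (h1.congr_of_eventuallyEq h2).fderiv]
  simp only [inner_sub_left, inner_smul_left, inner_gradient_left, conj_trivial,
    add_apply, smul_apply, innerSL_apply_apply, smul_eq_mul]
  ring

theorem ne_zero_of_norm_eq_one {x : Euc n} (hx : ‖x‖ = 1) : x ≠ 0 :=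
  norm_ne_zero_iff.mp (by rw [hx]; exact one_ne_zero)

theorem gradField_linComb_of_norm_eq_one (hF : F.IsHomogeneous k) {x : Euc n} (hx : ‖x‖ = 1) :
    gradField (fun z : Sph n => linComb a b (polyMap F) z) x =
      gradient (linComb a b (polyMap F)) x - (k * linComb a b (polyMap F) x) • x := by
  rw [gradField_linComb hF (ne_zero_of_norm_eq_one hx), hx]
  simp

theorem inner_gradField_gradField (hF : F.IsHomogeneous k) {x : Euc n} (hx : ‖x‖ = 1)
    (a' b' : ℝ) :
    inner ℝ (gradField (fun z : Sph n => linComb a b (polyMap F) z) x)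
        (gradField (fun z : Sph n => linComb a' b' (polyMap F) z) x) =
      inner ℝ (gradient (linComb a b (polyMap F)) x) (gradient (linComb a' b' (polyMap F)) x) -
        k ^ 2 * linComb a b (polyMap F) x * linComb a' b' (polyMap F) x := by
  have h1 : inner ℝ x (gradient (linComb a' b' (polyMap F)) x) =
      k * linComb a' b' (polyMap F) x := by
    rw [real_inner_comm, inner_gradient_self hF]
  rw [gradField_linComb_of_norm_eq_one hF hx, gradField_linComb_of_norm_eq_one hF hx]
  simp only [inner_sub_left, inner_sub_right, inner_smul_left, inner_smul_right, conj_trivial,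
    inner_gradient_self hF, h1, real_inner_self_eq_norm_sq x, hx]
  ring

theorem laplaceBeltrami_linComb (hF : F.IsHomogeneous k) (x : Sph n) :
    laplaceBeltrami (fun z : Sph n => linComb a b (polyMap F) z) x =
      linComb a b (polyMap (polyLaplacian F)) x -
        k * (n + k - 1) * linComb a b (polyMap F) x := by
  have hx := mem_sphere_zero_iff_norm.mp x.2
  have hxx : inner ℝ (x : Euc n) (x : Euc n) = (1 : ℝ) := by
    rw [real_inner_self_eq_norm_sq, hx, one_pow]
  have h0 := ne_zero_of_norm_eq_one hx
  have hP : ContDiffAt ℝ ∞ (linComb a b (polyMap F)) (x : Euc n) :=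
    (contDiff_linComb a b F).contDiffAt
  have hd := (hP.differentiableAt (by simp)).hasFDerivAt
  have hg := (hP.gradient_real.differentiableAt (by simp)).hasFDerivAt
  have hW : HasFDerivAt (fun y => gradient (linComb a b (polyMap F)) y -
      ((k * linComb a b (polyMap F) x : ℝ)) • y) _ (x : Euc n) :=
    hg.sub ((hasFDerivAt_id (x : Euc n)).const_smul (k * linComb a b (polyMap F) x))
  have hV := ((hasFDerivAt_norm_inv_pow k h0).smul hg).sub
    ((((hasFDerivAt_norm_inv_pow (k + 2) h0).const_mul (k : ℝ)).fun_mul hd).smul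
      (hasFDerivAt_id (x : Euc n)))
  have he : gradField (fun z : Sph n => linComb a b (polyMap F) z) =ᶠ[𝓝 (x : Euc n)]
      fun y => ‖y‖⁻¹ ^ k • gradient (linComb a b (polyMap F)) y -
        (k * ‖y‖⁻¹ ^ (k + 2) * linComb a b (polyMap F) y) • y := by
    filter_upwards [isOpen_ne.mem_nhds h0] with z hz using gradField_linComb hF hz
  -- For `v ⊥ x` the powers of the norm have derivative zero at `x`, and the derivative of `P`
  -- multiplies `x`, which is orthogonal to `v`. So the coefficient may be frozen at `x`.
  have hc := traceDeriv_congr (c := 1) (K := (ℝ ∙ (x : Euc n))ᗮ)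
    (V := gradField (fun z : Sph n => linComb a b (polyMap F) z))
    (W := fun y => gradient (linComb a b (polyMap F)) y -
      (k * linComb a b (polyMap F) x : ℝ) • y) (x := (x : Euc n)) (by
    intro v hv
    have hv := Submodule.mem_orthogonal_singleton_iff_inner_right.mp hv
    rw [hW.fderiv, (hV.congr_of_eventuallyEq he).fderiv]
    simp [inner_sub_left, inner_add_left, inner_smul_left, hv, hx])
  rw [laplaceBeltrami, hc, one_mul, traceDeriv_orthogonal_singleton hx, hW.fderiv]
  have ht : (fderiv ℝ (gradient (linComb a b (polyMap F))) (x : Euc n) -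
      (k * linComb a b (polyMap F) x : ℝ) • ContinuousLinearMap.id ℝ (Euc n)).toLinearMap =
      (fderiv ℝ (gradient (linComb a b (polyMap F))) (x : Euc n)).toLinearMap -
        (k * linComb a b (polyMap F) x : ℝ) • LinearMap.id := rfl
  rw [ht, map_sub, map_smul, trace_fderiv_gradient, LinearMap.trace_id, sub_apply,
    inner_sub_right, real_inner_comm, inner_fderiv_gradient hP, hess_self_self hF]
  simp only [smul_apply, ContinuousLinearMap.id_apply, inner_smul_right, hxx, smul_eq_mul,
    finrank_euclideanSpace, Fintype.card_fin]
  push_cast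
  ring

theorem linComb_one_zero (G : Euc n → ℂ) : linComb 1 0 G = fun y => (G y).re := by
  ext y; simp [linComb]

theorem linComb_zero_one (G : Euc n → ℂ) : linComb 0 1 G = fun y => (G y).im := by
  ext y; simp [linComb]

theorem linComb_eq (a b : ℝ) (G : Euc n → ℂ) :
    linComb a b G = fun y => a * linComb 1 0 G y + b * linComb 0 1 G y := by
  ext y; simp [linComb]

theorem laplaceBeltramiC_polyMap (hF : F.IsHomogeneous k) (x : Sph n) :
    laplaceBeltramiC (fun z : Sph n => polyMap F z) x =
      polyMap (polyLaplacian F) x - ((k * (n + k - 1) : ℝ) : ℂ) * polyMap F x := by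
  have h1 := laplaceBeltrami_linComb (a := 1) (b := 0) hF x
  have h2 := laplaceBeltrami_linComb (a := 0) (b := 1) hF x
  simp only [linComb_one_zero, linComb_zero_one] at h1 h2
  rw [laplaceBeltramiC, h1, h2]
  apply Complex.ext
  · simp
  · simp

/-- The eigenvalue equation on the sphere, extended to all of the Euclidean space. -/
theorem normSq_mul_polyLaplacian_eq (hF : F.IsHomogeneous k) {c : ℂ}
    (h : ∀ x : Sph n, polyMap (polyLaplacian F) x = c * polyMap F x) :
    (∑ i, X i ^ 2) * polyLaplacian F = C c * F := by
  -- Points with nonzero real coordinates suffice to identify polynomials, and they avoid the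
  -- origin, so they scale to the sphere.
  refine funext_set (fun _ => (fun r : ℝ => (r : ℂ)) '' {0}ᶜ) (fun _ =>
    ((Set.finite_singleton (0 : ℝ)).infinite_compl).image Complex.ofReal_injective.injOn)
    fun z hz => ?_
  choose r hr0 hr using fun i => hz i (Set.mem_univ i)
  obtain ⟨x, hx⟩ : ∃ x : Euc n, ∀ i, (x i : ℂ) = z i := ⟨WithLp.toLp 2 r, hr⟩
  have hx0 : x ≠ 0 := by
    rintro rfl
    exact hr0 0 (by simpa [← hr 0] using (hx 0).symm)
  obtain rfl : (fun i => (x i : ℂ)) = z := funext hx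
  have hn : ‖x‖ ≠ 0 := norm_ne_zero_iff.mpr hx0
  obtain ⟨y, hy⟩ : ∃ y : Sph n, x = ‖x‖ • (y : Euc n) :=
    ⟨⟨‖x‖⁻¹ • x, by rw [mem_sphere_zero_iff_norm, norm_smul, norm_inv, norm_norm,
      inv_mul_cancel₀ hn]⟩, by simp [smul_smul, hn]⟩
  have h1 : polyMap F x = (‖x‖ : ℂ) ^ k * polyMap F y := by
    conv_lhs => rw [hy]
    exact polyMap_smul hF _ _
  have h2 : polyMap (polyLaplacian F) x =
      (‖x‖ : ℂ) ^ (k - 1 - 1) * polyMap (polyLaplacian F) y := by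
    conv_lhs => rw [hy]
    exact polyMap_smul (isHomogeneous_polyLaplacian hF) _ _
  have h3 : (∑ i, (x i : ℂ) ^ 2) = (‖x‖ : ℂ) ^ 2 := by
    rw [← Complex.ofReal_pow, EuclideanSpace.real_norm_sq_eq]
    push_cast
    rfl
  simp only [map_mul, map_sum, map_pow, eval_X, eval_C]
  change (∑ i, (x i : ℂ) ^ 2) * polyMap (polyLaplacian F) x = c * polyMap F x
  rw [h3]
  -- For `k ≤ 1` the degree `k - 1 - 1` truncates and scaling does not match, but then `ΔF = 0`.
  rcases le_or_gt k 1 with hk | hk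
  · have h4 := h y
    have h5 : polyMap (n := n) (polyLaplacian F) = fun _ => 0 := by
      rw [polyLaplacian_eq_zero hF hk]
      ext; simp [polyMap]
    rw [h5] at h4 ⊢
    rw [h1, mul_left_comm, ← h4]
    simp
  · obtain ⟨m, rfl⟩ : ∃ m, k = m + 2 := ⟨k - 2, by omega⟩
    rw [h1, h2, h]
    rw [show m + 2 - 1 - 1 = m by omega]
    ring

/-- On its zero set in the sphere, a real component of an eigenfunction that is the restriction
of a homogeneous polynomial has vanishing Euclidean Laplacian. -/
theorem linComb_polyLaplacian_eq_zero (hF : F.IsHomogeneous k) {lam : ℂ}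
    (h : ∀ x : Sph n, laplaceBeltramiC (fun z : Sph n => polyMap F z) x = lam * polyMap F x)
    {x : Sph n} (hx : linComb a b (polyMap F) x = 0) :
    linComb a b (polyMap (polyLaplacian F)) x = 0 := by
  set c : ℂ := lam + ((k * (n + k - 1) : ℝ) : ℂ) with hc
  have h1 : ∀ x : Sph n, polyMap (polyLaplacian F) x = c * polyMap F x := fun x => by
    have := h x
    rw [laplaceBeltramiC_polyMap hF] at this
    rw [hc, add_mul, ← this]
    ring
  by_cases h0 : F = 0
  · simp [h0, polyLaplacian, linComb, polyMap]
  · have him := im_eq_zero_of_normSq_mul_polyLaplacian k F c hF h0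
      (normSq_mul_polyLaplacian_eq hF h1)
    have h2 : linComb a b (polyMap (polyLaplacian F)) (x : Euc n) =
        c.re * linComb a b (polyMap F) x := by
      simp only [linComb, h1, Complex.mul_re, Complex.mul_im, him]
      ring
    rw [h2, hx, mul_zero]

end Restriction

/-! ### Submersive points -/

section Submersion

variable {n k : ℕ} {a b : ℝ} {F : MvPolynomial (Fin (n + 1)) ℂ}

theorem gradient_linComb_eq (a b : ℝ) (F : MvPolynomial (Fin (n + 1)) ℂ) (x : Euc n) :
    gradient (linComb a b (polyMap F)) x =
      a • gradient (linComb 1 0 (polyMap F)) x + b • gradient (linComb 0 1 (polyMap F)) x := by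
  ext i
  simp only [PiLp.add_apply, PiLp.smul_apply, gradient_linComb_polyMap_apply, smul_eq_mul]
  rw [linComb_eq]

theorem fderiv_linComb_eq (a b : ℝ) (F : MvPolynomial (Fin (n + 1)) ℂ) (x v : Euc n) :
    fderiv ℝ (linComb a b (polyMap F)) x v =
      a * (fderiv ℝ (polyMap F) x v).re + b * (fderiv ℝ (polyMap F) x v).im := by
  have h := (hasFDerivAt_polyMap F x).differentiableAt.hasFDerivAt
  have h1 : HasFDerivAt (linComb a b (polyMap F)) _ x :=
    ((Complex.reCLM.hasFDerivAt.comp x h).const_mul a).add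
      ((Complex.imCLM.hasFDerivAt.comp x h).const_mul b)
  rw [h1.fderiv]
  simp

/-- A vector `v` with `dF v = a + i b` has `dP v = a² + b² ≠ 0`. -/
theorem gradient_ne_zero_of_isSubmersiveAt (hab : ¬ (a = 0 ∧ b = 0)) {x : Euc n}
    (h : IsSubmersiveAt (polyMap F) x) : gradient (linComb a b (polyMap F)) x ≠ 0 := by
  intro h0
  obtain ⟨v, hv⟩ := h ⟨a, b⟩
  have h1 := fderiv_linComb_eq a b F x v
  rw [← inner_gradient_left, h0, inner_zero_left, hv] at h1
  dsimp only at h1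
  exact hab ⟨by nlinarith, by nlinarith⟩

/-- If `dF` is not onto, its range lies in the kernel of a nonzero real functional `p Re + q Im` on
`ℂ`. -/
theorem isSubmersiveAt_of_forall {x : Euc n}
    (h : ∀ p q : ℝ, gradient (linComb p q (polyMap F)) x = 0 → p = 0 ∧ q = 0) :
    IsSubmersiveAt (polyMap F) x := by
  by_contra hs
  have hr : (fderiv ℝ (polyMap F) x).range < ⊤ :=
    lt_top_iff_ne_top.mpr fun h => hs (LinearMap.range_eq_top.mp h)
  obtain ⟨f, hf0, hf⟩ := Submodule.exists_le_ker_of_lt_top _ hr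
  have hfz : ∀ z : ℂ, f z = f 1 * z.re + f Complex.I * z.im := fun z => by
    have hz : z = z.re • (1 : ℂ) + z.im • Complex.I := by
      apply Complex.ext <;> simp
    conv_lhs => rw [hz]
    rw [map_add, map_smul, map_smul, smul_eq_mul, smul_eq_mul]
    ring
  obtain ⟨h1, h2⟩ := h (f 1) (f Complex.I) (ext_inner_right ℝ fun v => by
    rw [inner_gradient_left, fderiv_linComb_eq, ← hfz, inner_zero_left]
    exact hf ⟨v, rfl⟩)
  exact hf0 (LinearMap.ext fun z => by rw [hfz, h1, h2]; simp)

/-- At a zero on the sphere where the gradient of `a Re F + b Im F` does not vanish, `F` is a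
submersion. -/
theorem isSubmersiveAt_of_gradient_ne_zero (hF : F.IsHomogeneous k) {mu : ℂ} {x : Sph n}
    (hgrad : gradSq (fun z : Sph n => polyMap F z) x = mu * polyMap F x ^ 2)
    (hx : linComb a b (polyMap F) x = 0) (h0 : gradient (linComb a b (polyMap F)) x ≠ 0) :
    IsSubmersiveAt (polyMap F) (x : Euc n) := by
  have hn := mem_sphere_zero_iff_norm.mp x.2
  by_cases hz : polyMap F (x : Euc n) = 0
  -- At a zero of `F` the gradient equation reads `‖u‖ = ‖v‖`, `⟪u, v⟫ = 0` for the gradients `u`,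
  -- `v` of `Re F`, `Im F`; as `u`, `v` are not both zero, they are independent.
  · have hre : linComb 1 0 (polyMap F) (x : Euc n) = 0 := by simp [linComb, hz]
    have him : linComb 0 1 (polyMap F) (x : Euc n) = 0 := by simp [linComb, hz]
    have h11 := inner_gradField_gradField (a := 1) (b := 0) hF hn 1 0
    have h12 := inner_gradField_gradField (a := 1) (b := 0) hF hn 0 1
    have h22 := inner_gradField_gradField (a := 0) (b := 1) hF hn 0 1
    rw [hre] at h11 h12
    rw [him] at h22
    simp only [linComb_one_zero, linComb_zero_one, mul_zero, zero_mul, sub_zero] at h11 h12 h22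
    rw [gradSq, h11, h12, h22, hz, zero_pow two_ne_zero, mul_zero] at hgrad
    have e1 := congrArg Complex.re hgrad
    have e2 := congrArg Complex.im hgrad
    simp only [← linComb_one_zero, ← linComb_zero_one] at e1 e2
    simp only [Complex.add_re, Complex.sub_re, Complex.ofReal_re, Complex.mul_re, Complex.re_ofNat,
      Complex.I_re, Complex.im_ofNat, Complex.I_im, Complex.ofReal_im, Complex.add_im,
      Complex.sub_im, Complex.mul_im, Complex.zero_re, Complex.zero_im] at e1 e2
    set u := gradient (linComb 1 0 (polyMap F)) (x : Euc n) with hu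
    set v := gradient (linComb 0 1 (polyMap F)) (x : Euc n) with hv
    have huv : (inner ℝ u v : ℝ) = 0 := by linarith
    have huu : (inner ℝ u u : ℝ) = inner ℝ v v := by linarith
    have hu0 : (inner ℝ u u : ℝ) ≠ 0 := by
      intro h
      have hu' : u = 0 := inner_self_eq_zero.mp h
      have hv' : v = 0 := inner_self_eq_zero.mp (huu ▸ h)
      exact h0 (by rw [gradient_linComb_eq, ← hu, ← hv, hu', hv']; simp)
    refine isSubmersiveAt_of_forall fun p q hpq => ?_
    rw [gradient_linComb_eq, ← hu, ← hv] at hpq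
    have f1 := congrArg (fun w => (inner ℝ u w : ℝ)) hpq
    have f2 := congrArg (fun w => (inner ℝ v w : ℝ)) hpq
    simp only [inner_add_right, inner_smul_right, huv, inner_zero_right, mul_zero, add_zero,
      zero_add, real_inner_comm u v, ← huu] at f1 f2
    exact ⟨(mul_eq_zero.mp f1).resolve_right hu0, (mul_eq_zero.mp f2).resolve_right hu0⟩
  · have hk : k ≠ 0 := by
      rintro rfl
      refine h0 (PiLp.ext fun i => ?_)
      rw [gradient_linComb_polyMap_apply, pderiv_eq_zero_of_isHomogeneous_zero hF]
      simp [linComb, polyMap]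
    -- Where `F ≠ 0`, Euler turns a vanishing gradient of `p Re F + q Im F` into `p Re F + q Im F =
    -- 0`. Hence `(p, q)` is proportional to `(a, b)`, and `grad P ≠ 0` forces `p = q = 0`.
    refine isSubmersiveAt_of_forall fun p q hpq => ?_
    have h1 := inner_gradient_self (a := p) (b := q) hF (x : Euc n)
    rw [hpq, inner_zero_left, eq_comm, mul_eq_zero, Nat.cast_eq_zero] at h1
    have h2 : p * (polyMap F x).re + q * (polyMap F x).im = 0 := h1.resolve_left hk
    have h3 : a * (polyMap F x).re + b * (polyMap F x).im = 0 := hx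
    have h4 : a * q - b * p = 0 := by
      by_contra h4
      refine hz (Complex.ext ?_ ?_)
      · exact (mul_eq_zero.mp (by linear_combination q * h3 - b * h2 :
          (a * q - b * p) * (polyMap F x).re = 0)).resolve_left h4
      · exact (mul_eq_zero.mp (by linear_combination a * h2 - p * h3 :
          (a * q - b * p) * (polyMap F x).im = 0)).resolve_left h4
    have h5 : p • gradient (linComb a b (polyMap F)) (x : Euc n) = 0 := by
      have : p • gradient (linComb a b (polyMap F)) (x : Euc n) =
          a • gradient (linComb p q (polyMap F)) (x : Euc n) := by
        rw [gradient_linComb_eq a b, gradient_linComb_eq p q, smul_add, smul_add, smul_smul,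
          smul_smul, smul_smul, smul_smul, mul_comm p a, show p * b = a * q by linarith]
      rw [this, hpq, smul_zero]
    have h6 : q • gradient (linComb a b (polyMap F)) (x : Euc n) = 0 := by
      have : q • gradient (linComb a b (polyMap F)) (x : Euc n) =
          b • gradient (linComb p q (polyMap F)) (x : Euc n) := by
        rw [gradient_linComb_eq a b, gradient_linComb_eq p q, smul_add, smul_add, smul_smul,
          smul_smul, smul_smul, smul_smul, mul_comm q b, show q * a = b * p by linarith]
      rw [this, hpq, smul_zero]
    exact ⟨(smul_eq_zero.mp h5).resolve_right h0, (smul_eq_zero.mp h6).resolve_right h0⟩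

end Submersion

/-! ### The mean curvature and the Hessian -/

section Hessian

variable {n k : ℕ} {a b : ℝ} {F : MvPolynomial (Fin (n + 1)) ℂ}

theorem tanGrad_linComb (hF : F.IsHomogeneous k) {x : Euc n}
    (hx : linComb a b (polyMap F) x = 0) :
    tanGrad (linComb a b (polyMap F)) x = gradient (linComb a b (polyMap F)) x := by
  rw [tanGrad, inner_gradient_self hF, hx, mul_zero, zero_smul, sub_zero]

theorem meanCurvature_linComb_eq_zero_iff (hF : F.IsHomogeneous k) {x : Euc n} (hn : ‖x‖ = 1)
    (hx : linComb a b (polyMap F) x = 0) (h0 : gradient (linComb a b (polyMap F)) x ≠ 0)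
    (hL : linComb a b (polyMap (polyLaplacian F)) x = 0) :
    meanCurvature (linComb a b (polyMap F)) x = 0 ↔
      hess (linComb a b (polyMap F)) x (gradient (linComb a b (polyMap F)) x)
        (gradient (linComb a b (polyMap F)) x) = 0 := by
  have hP : ContDiffAt ℝ ∞ (linComb a b (polyMap F)) x := (contDiff_linComb a b F).contDiffAt
  have ht := tanGrad_linComb hF hx
  have hg := (hP.gradient_real.differentiableAt (by simp)).hasFDerivAt
  have hT : HasFDerivAt (tanGrad (linComb a b (polyMap F))) _ x :=
    hg.fun_sub ((hg.inner ℝ (hasFDerivAt_id x)).smul (hasFDerivAt_id x))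
  set w := gradient (linComb a b (polyMap F)) x with hw
  have hgx : inner ℝ w x = (0 : ℝ) := by rw [hw, inner_gradient_self hF, hx, mul_zero]
  -- The radial correction in `tanGrad` contributes nothing: its derivative along `v` is a multiple
  -- of `x` plus `⟪w, x⟫ v`, and `⟪w, x⟫ = 0`.
  have hc := traceDeriv_congr (c := 1) (K := hyperTangent (linComb a b (polyMap F)) x)
    (V := tanGrad (linComb a b (polyMap F))) (W := gradient (linComb a b (polyMap F))) (x := x) (by
    intro v hv
    have hv : inner ℝ x v = (0 : ℝ) :=
      (Submodule.mem_orthogonal _ v).mp hv _ (Submodule.subset_span (by simp))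
    rw [hT.fderiv]
    simp [inner_sub_left, inner_smul_left, hv, hgx])
  have hν : unitNormal (linComb a b (polyMap F)) x = ‖w‖⁻¹ • w := by rw [unitNormal, ht]
  have hν1 : ‖‖w‖⁻¹ • w‖ = 1 := by
    rw [norm_smul, norm_inv, norm_norm, inv_mul_cancel₀ (norm_ne_zero_iff.mpr h0)]
  have hνx : inner ℝ x (‖w‖⁻¹ • w) = (0 : ℝ) := by
    rw [inner_smul_right, real_inner_comm, hgx, mul_zero]
  rw [meanCurvature_eq hP (by rwa [ht]), hc, hyperTangent, hν,
    traceDeriv_orthogonal_pair hn hν1 hνx, trace_fderiv_gradient, hL, ht,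
    real_inner_comm, inner_fderiv_gradient hP, hess_self_self hF, hx, map_smul,
    inner_smul_left, inner_smul_right, real_inner_comm, inner_fderiv_gradient hP]
  have hw0 : ‖w‖ ≠ 0 := norm_ne_zero_iff.mpr h0
  simp [hw0]

/-- The cubic form `Hess P (grad P, grad P)` in coordinates. -/
theorem hess_gradient_gradient (a b : ℝ) (F : MvPolynomial (Fin (n + 1)) ℂ) (x : Euc n) :
    hess (linComb a b (polyMap F)) x (gradient (linComb a b (polyMap F)) x)
        (gradient (linComb a b (polyMap F)) x) =
      ∑ j, linComb a b (polyMap (pderiv j F)) x * ∑ i, linComb a b (polyMap (pderiv i F)) x *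
        linComb a b (polyMap (pderiv i (pderiv j F))) x := by
  simp only [hess_linComb_polyMap, gradient_linComb_polyMap_apply]

theorem hess_gradient_gradient_smul (hF : F.IsHomogeneous k) (t : ℝ) (x : Euc n) :
    hess (linComb a b (polyMap F)) (t • x) (gradient (linComb a b (polyMap F)) (t • x))
        (gradient (linComb a b (polyMap F)) (t • x)) =
      t ^ ((k - 1) + (k - 1) + (k - 1 - 1)) *
        hess (linComb a b (polyMap F)) x (gradient (linComb a b (polyMap F)) x)
          (gradient (linComb a b (polyMap F)) x) := by
  simp only [hess_gradient_gradient, linComb_polyMap_smul hF.pderiv,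
    linComb_polyMap_smul hF.pderiv.pderiv, Finset.mul_sum]
  refine Finset.sum_congr rfl fun j _ => Finset.sum_congr rfl fun i _ => ?_
  rw [pow_add, pow_add]
  ring

theorem hess_gradient_gradient_zero (hF : F.IsHomogeneous k) :
    hess (linComb a b (polyMap F)) 0 (gradient (linComb a b (polyMap F)) 0)
        (gradient (linComb a b (polyMap F)) 0) = 0 := by
  -- For `k ≤ 1` the scaling exponent is `0`, but second derivatives vanish; otherwise it is
  -- positive and `t = 0` suffices.
  rcases le_or_gt k 1 with hk | hk
  · rw [hess_gradient_gradient]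
    simp [pderiv_pderiv_eq_zero hF hk, linComb, polyMap]
  · have := hess_gradient_gradient_smul (a := a) (b := b) hF 0 0
    rwa [zero_smul, zero_pow (by omega), zero_mul] at this

/-- By homogeneity, the vanishing of `Hess P (grad P, grad P)` on the cone of zeros of `P` can be
tested at the points of the sphere where `grad P` does not vanish. -/
theorem forall_hess_eq_zero_iff (hF : F.IsHomogeneous k) :
    (∀ x ∈ polyMap F ⁻¹' line a b, hess (linComb a b (polyMap F)) x
        (gradient (linComb a b (polyMap F)) x) (gradient (linComb a b (polyMap F)) x) = 0) ↔
      ∀ x : Sph n, linComb a b (polyMap F) x = 0 → gradient (linComb a b (polyMap F)) x ≠ 0 →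
        hess (linComb a b (polyMap F)) x (gradient (linComb a b (polyMap F)) x)
          (gradient (linComb a b (polyMap F)) x) = 0 := by
  refine ⟨fun h x hx _ => h x hx, fun h x hx => ?_⟩
  rcases eq_or_ne x 0 with rfl | hx0
  · exact hess_gradient_gradient_zero hF
  have hn : ‖x‖ ≠ 0 := norm_ne_zero_iff.mpr hx0
  obtain ⟨y, hy⟩ : ∃ y : Sph n, x = ‖x‖ • (y : Euc n) :=
    ⟨⟨‖x‖⁻¹ • x, by rw [mem_sphere_zero_iff_norm, norm_smul, norm_inv, norm_norm,
      inv_mul_cancel₀ hn]⟩, by simp [smul_smul, hn]⟩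
  have hx' : linComb a b (polyMap F) x = 0 := hx
  have hy0 : linComb a b (polyMap F) y = 0 := by
    rw [hy, linComb_polyMap_smul hF] at hx'
    exact (mul_eq_zero.mp hx').resolve_left (pow_ne_zero _ hn)
  rw [hy, hess_gradient_gradient_smul hF]
  by_cases hg : gradient (linComb a b (polyMap F)) (y : Euc n) = 0
  · rw [hg]; simp [hess]
  · rw [h y hy0 hg, mul_zero]

/-- The nonsingular zeros of `P` on the sphere have `P` as a defining function. -/
theorem isLocalDefining_linComb (hF : F.IsHomogeneous k) {M : Set (Sph n)}
    (hM : ∀ x, x ∈ M ↔ linComb a b (polyMap F) (x : Euc n) = 0 ∧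
      gradient (linComb a b (polyMap F)) (x : Euc n) ≠ 0) :
    IsLocalDefining M {y | gradient (linComb a b (polyMap F)) y ≠ 0}
      (linComb a b (polyMap F)) where
  isOpen := isOpen_ne_fun (continuous_iff_continuousAt.mpr fun _ =>
    (contDiff_linComb a b F).contDiffAt.gradient_real.continuousAt) continuous_const
  smooth := (contDiff_linComb a b F).contDiffOn
  mem_iff y hy := by rw [hM]; exact and_iff_left hy
  regular y hy hyM := by rwa [tanGrad_linComb hF ((hM y).mp hyM).1]

theorem isMinimalHypersurface_iff (hF : F.IsHomogeneous k) {M : Set (Sph n)}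
    (hM : ∀ x, x ∈ M ↔ linComb a b (polyMap F) (x : Euc n) = 0 ∧
      gradient (linComb a b (polyMap F)) (x : Euc n) ≠ 0) :
    IsMinimalHypersurface M ↔ ∀ x ∈ M, meanCurvature (linComb a b (polyMap F)) x = 0 := by
  have hP := isLocalDefining_linComb hF hM
  constructor
  · exact fun h x hx => h.2 x hx _ _ ((hM x).mp hx).2 hP
  · exact fun h => ⟨fun x hx => ⟨_, _, ((hM x).mp hx).2, hP⟩, fun x hx W φ hW hφ =>
      hφ.meanCurvature_eq_zero hP hx hW ((hM x).mp hx).2 (h x hx)⟩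

end Hessian

end SphereEigen

/-! ### The two equivalences -/

theorem theorem3 (n k : ℕ) (F : MvPolynomial (Fin (n + 1)) ℂ) (hF : F.IsHomogeneous k)
    (f : SphereEigen.Sph n → ℂ) (hfF : ∀ x, f x = SphereEigen.polyMap F x)
    (lam mu : ℂ) (hf : SphereEigen.IsEigenfunction f lam mu)
    (a b : ℝ) (hab : ¬ (a = 0 ∧ b = 0)) :
    ((∀ x, f x ∈ SphereEigen.line a b → SphereEigen.IsSubmersiveAt (SphereEigen.polyMap F) x) →
      (SphereEigen.IsMinimalHypersurface (f ⁻¹' SphereEigen.line a b) ↔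
        ∀ x ∈ SphereEigen.polyMap F ⁻¹' SphereEigen.line a b,
          SphereEigen.hess (SphereEigen.linComb a b (SphereEigen.polyMap F)) x
            (gradient (SphereEigen.linComb a b (SphereEigen.polyMap F)) x)
            (gradient (SphereEigen.linComb a b (SphereEigen.polyMap F)) x) = 0)) ∧
    (SphereEigen.IsMinimalHypersurface
        {x | f x ∈ SphereEigen.line a b ∧ SphereEigen.IsSubmersiveAt (SphereEigen.polyMap F) x} ↔
      ∀ x ∈ SphereEigen.polyMap F ⁻¹' SphereEigen.line a b,
        SphereEigen.hess (SphereEigen.linComb a b (SphereEigen.polyMap F)) x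
          (gradient (SphereEigen.linComb a b (SphereEigen.polyMap F)) x)
          (gradient (SphereEigen.linComb a b (SphereEigen.polyMap F)) x) = 0) := by
  obtain rfl : f = fun z : SphereEigen.Sph n => SphereEigen.polyMap F z := funext hfF
  have hM : ∀ x : SphereEigen.Sph n,
      x ∈ {x : SphereEigen.Sph n | SphereEigen.polyMap F x ∈ SphereEigen.line a b ∧
        SphereEigen.IsSubmersiveAt (SphereEigen.polyMap F) x} ↔
      SphereEigen.linComb a b (SphereEigen.polyMap F) x = 0 ∧
        gradient (SphereEigen.linComb a b (SphereEigen.polyMap F)) (x : SphereEigen.Euc n) ≠ 0 :=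
    fun x => and_congr_right fun hx =>
      ⟨SphereEigen.gradient_ne_zero_of_isSubmersiveAt hab,
        SphereEigen.isSubmersiveAt_of_gradient_ne_zero hF (hf.grad x) hx⟩
  have main := SphereEigen.isMinimalHypersurface_iff hF hM
  rw [SphereEigen.forall_hess_eq_zero_iff hF]
  have key : SphereEigen.IsMinimalHypersurface
      {x : SphereEigen.Sph n | SphereEigen.polyMap F x ∈ SphereEigen.line a b ∧
        SphereEigen.IsSubmersiveAt (SphereEigen.polyMap F) x} ↔
      ∀ x : SphereEigen.Sph n, SphereEigen.linComb a b (SphereEigen.polyMap F) x = 0 →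
        gradient (SphereEigen.linComb a b (SphereEigen.polyMap F)) x ≠ 0 →
        SphereEigen.hess (SphereEigen.linComb a b (SphereEigen.polyMap F)) x
          (gradient (SphereEigen.linComb a b (SphereEigen.polyMap F)) x)
          (gradient (SphereEigen.linComb a b (SphereEigen.polyMap F)) x) = 0 := by
    rw [main]
    have hiff : ∀ x : SphereEigen.Sph n, SphereEigen.linComb a b (SphereEigen.polyMap F) x = 0 →
        gradient (SphereEigen.linComb a b (SphereEigen.polyMap F)) (x : SphereEigen.Euc n) ≠ 0 →
        _ :=
      fun x hx hg => SphereEigen.meanCurvature_linComb_eq_zero_iff hF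
        (mem_sphere_zero_iff_norm.mp x.2) hx hg
        (SphereEigen.linComb_polyLaplacian_eq_zero hF hf.laplace hx)
    constructor
    · exact fun h x hx hg => (hiff x hx hg).mp (h x ((hM x).mpr ⟨hx, hg⟩))
    · intro h x hx
      obtain ⟨h1, h2⟩ := (hM x).mp hx
      exact (hiff x h1 h2).mpr (h x h1 h2)
  refine ⟨fun hsub => ?_, key⟩
  -- Under the submersion hypothesis no point is removed, so the first equivalence is a case of the
  -- second.
  have hset : {x : SphereEigen.Sph n | SphereEigen.polyMap F x ∈ SphereEigen.line a b} =
      {x : SphereEigen.Sph n | SphereEigen.polyMap F x ∈ SphereEigen.line a b ∧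
        SphereEigen.IsSubmersiveAt (SphereEigen.polyMap F) x} :=
    Set.ext fun x => (and_iff_left_of_imp (hsub x)).symm
  rw [← key, ← hset]
  rfl
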